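/- Let $p$ be a prime, $e\ge 1$, $q=p^e$, and let $\mathbb F_q$ be the field with $q$ elements. For $i\ge 1$ let $I_i$ be the set of monic irreducible polynomials of degree $i$ over $\mathbb F_q$. For a monic polynomial $f=x^{d}+f_1x^{d-1}+\cdots+f_d$ over $\mathbb F_q$ put $\langle f\rangle=x^{d}f(1/x) \bmod x^{2}=1+f_1x \bmod x^2$ (with $f_1=0$ if $d=0$). Let $T$ be a finite set of positive integers, let $r_i\ge 0$ be an integer for each $i\in T$, let $m\ge 0$ be an integer and let $\alpha\in\mathbb F_q$. Let $N(m,\prod_{i\in T}I_i^{r_i},\langle x+\alpha\rangle)$ be the number of monic polynomials $g$ of degree $m$ over $\mathbb F_q$ with $\langle g\rangle=\langle x+\alpha\rangle$ such that, for each $i\in T$, $g$ has exactly $r_i$ distinct monic irreducible factors of degree $i$. Write $[P]=1$ if $P$ is true and $[P]=0$ otherwise, and $v(\alpha)=q[\alpha=0]-1$. Put $$S=q^{m-1}\Big(\prod_{i\in T}\binom{|I_i|}{r_i}q^{-ir_i}\Big)\sum_{(j_i)_{i\in T}}\Big(\prod_{i\in T}q^{-ij_i}\binom{|I_i|-r_i}{j_i}(-1)^{j_i}\Big)\Big[\sum_{i\in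 T}i(r_i+j_i)\le m\Big],$$ where $(j_i)$ runs over all families of integers with $0\le j_i\le |I_i|-r_i$ for each $i\in T$ ($S=0$ if $r_i>|I_i|$ for some $i\in T$). Suppose that $p\nmid i$ for each $i\in T$. Then $p$ divides $|I_i|$ for each $i\in T$, and the following holds. If $p\nmid m$, then $N(m,\prod_{i\in T}I_i^{r_i},\langle x+\alpha\rangle)=S$. If $p\mid m$, then $$N\Big(m,\prod_{i\in T}I_i^{r_i},\langle x+\alpha\rangle\Big)=S+\frac{v(\alpha)}{q}\sum_{(k_i)_{i\in T}}\Big(\prod_{i\in T}\binom{|I_i|/p}{k_i}\binom{pk_i}{r_i}(-1)^{k_i-r_i}\Big)\Big[\sum_{i\in T}ik_i=m/p\Big],$$ where $(k_i)$ runs over all families of integers with $0\le k_i\le |I_i|/p$ for each $i\in T$. -/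

import Mathlib

open Polynomial

namespace PrescribedFactors

/-- The class `⟨f⟩_w = x^{d(f)} f(1/x) mod x^{w+1}` of a polynomial. `Polynomial.reverse f` is
`x^{d(f)} f(1/x)`. -/
noncomputable def coeffClass {F : Type*} [Field F] (w : ℕ) (f : F[X]) :
    F[X] ⧸ Ideal.span {(X : F[X]) ^ (w + 1)} :=
  Ideal.Quotient.mk _ f.reverse

/-- `I_i`: the monic irreducible polynomials of degree `i`. -/
def monicIrred (F : Type*) [Field F] (i : ℕ) : Set F[X] :=
  {h | h.Monic ∧ Irreducible h ∧ h.natDegree = i}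

/-- `r_i(g)`: the number of distinct monic irreducible factors of `g` of degree `i`. -/
noncomputable def numDistinctFactors {F : Type*} [Field F] (i : ℕ) (g : F[X]) : ℕ :=
  {h ∈ monicIrred F i | h ∣ g}.ncard

/-- `N(m, ∏_{i ∈ T} I_i^{r_i}, ⟨f⟩_w)`: the number of monic `g` of degree `m` with
`⟨g⟩_w = ⟨f⟩_w` which have exactly `r_i` distinct monic irreducible factors of degree `i`,
for each `i ∈ T`. -/
noncomputable def N {F : Type*} [Field F] (w m : ℕ) (T : Finset ℕ) (r : T → ℕ) (f : F[X]) : ℕ :=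
  {g : F[X] | g.Monic ∧ g.natDegree = m ∧ coeffClass w g = coeffClass w f ∧
    ∀ i : T, numDistinctFactors (i : ℕ) g = r i}.ncard

open Classical in
/-- `v(α) = q ⟦α = 0⟧ - 1`, where `q` is the number of elements of the field. -/
noncomputable def v {F : Type*} [Field F] (α : F) : ℚ :=
  (Nat.card F : ℚ) * (if α = 0 then 1 else 0) - 1

end PrescribedFactors

/-! For monic `g` the class modulo `x^2` records exactly `g.nextCoeff`, which is additive on
products of monic polynomials. Fourier inversion over the additive characters `ψ` of `F`
(`card_mul_N_one_eq`) reduces the count to sums of `ψ g.nextCoeff`. Inclusion-exclusion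
(`sum_numDistinctFactors_eq`) turns these into sums over products `Q` of distinct irreducibles, with
a factor `monicCharSum ψ (m - Q.natDegree)`.

The trivial character gives `S`. For nontrivial `ψ` only `Q` of degree exactly `m` survive. When `p
∤ i`, a translation `x ↦ x + b/i` permutes `I_i` and adds `b` to `nextCoeff`, so the values of `ψ`
on `I_i` are equidistributed among the `p`-th roots of unity (`exists_monicIrred_prod_eq`). Hence
only subsets of size `p * k` contribute, the result does not depend on `ψ`, and it vanishes unless
`p ∣ m`. The weights `ψ (-α)` of the nontrivial characters add up to `v α`. -/

namespace PrescribedFactors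

/-! ### Inversion weights, fibre sums and equidistribution on roots of unity. -/

section Combinatorics

/-- The inversion weight `(-1)^(s-r) * (s choose r)`: summing it over the sizes `s` of all subsets
of a finite set detects whether that set has exactly `r` elements. -/
def inversionWeight (s r : ℕ) : ℂ := (s.choose r : ℂ) * (-1) ^ (s + r)

lemma sum_powerset_inversionWeight {α : Type*} (A : Finset α) (r : ℕ) :
    ∑ D ∈ A.powerset, inversionWeight D.card r = if A.card = r then 1 else 0 := by
  rw [Finset.sum_powerset_apply_card (fun s => inversionWeight s r)]
  rcases lt_or_ge A.card r with h | h
  · rw [if_neg h.ne]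
    refine Finset.sum_eq_zero fun s hs => ?_
    have : s < r := by simp at hs; omega
    simp [inversionWeight, Nat.choose_eq_zero_of_lt this]
  · obtain ⟨t, ht⟩ := Nat.exists_eq_add_of_le h
    rw [ht, add_assoc, Finset.sum_range_add]
    have h0 : ∑ s ∈ Finset.range r, (r + t).choose s • inversionWeight s r = 0 := by
      refine Finset.sum_eq_zero fun s hs => ?_
      simp [inversionWeight, Nat.choose_eq_zero_of_lt (Finset.mem_range.1 hs)]
    have h1 : ∀ x, (r + t).choose (r + x) • inversionWeight (r + x) r =
        ((r + t).choose r : ℂ) * (((-1 : ℤ) ^ x * (t.choose x : ℤ) : ℤ) : ℂ) := by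
      intro x
      have := Nat.choose_mul (n := r + t) (k := r + x) (s := r) (by omega)
      simp only [Nat.add_sub_cancel_left] at this
      have h2 : ((r + t).choose (r + x) : ℂ) * ((r + x).choose r : ℂ) =
        ((r + t).choose r : ℂ) * (t.choose x : ℂ) := by exact_mod_cast this
      have h3 : (-1 : ℂ) ^ (r + x + r) = (-1) ^ x := by
        rw [show r + x + r = x + 2 * r by ring, pow_add, pow_mul]; simp
      rw [inversionWeight, nsmul_eq_mul, ← mul_assoc, h2, h3]
      push_cast; ring
    simp only [h0, h1, zero_add, ← Finset.mul_sum]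
    rw [← Int.cast_sum, Int.alternating_sum_range_choose]
    by_cases ht0 : t = 0
    · simp [ht0]
    · simp [ht0]

/-- Follows from `(n choose r+t) (r+t choose r) = (n choose r) (n-r choose t)`; the index `j` is the
excess `s - r`. -/
lemma sum_powerset_inversionWeight_fiber {α : Type*} (A : Finset α) (r s : ℕ) :
    ∑ D ∈ A.powerset with D.card = s, inversionWeight D.card r =
      ∑ j ∈ Finset.range (A.card - r + 1) with r + j = s,
        (A.card.choose r : ℂ) * ((A.card - r).choose j * (-1) ^ j) := by
  rw [← Finset.powersetCard_eq_filter,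
    Finset.sum_congr rfl (fun D hD => by rw [(Finset.mem_powersetCard.1 hD).2]),
    Finset.sum_const, Finset.card_powersetCard, nsmul_eq_mul, inversionWeight]
  rcases lt_or_ge s r with h | h
  · rw [Nat.choose_eq_zero_of_lt h, Finset.sum_eq_zero]
    · simp
    · intro j hj; simp at hj; omega
  obtain ⟨t, rfl⟩ := Nat.exists_eq_add_of_le h
  have h3 : (-1 : ℂ) ^ (r + t + r) = (-1) ^ t := by
    rw [show r + t + r = t + 2 * r by ring, pow_add, pow_mul]; simp
  have h2 : (A.card.choose (r + t) : ℂ) * ((r + t).choose r : ℂ) =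
      (A.card.choose r : ℂ) * ((A.card - r).choose t : ℂ) := by
    have := Nat.choose_mul (n := A.card) (k := r + t) (s := r) (by omega)
    simp only [Nat.add_sub_cancel_left] at this
    exact_mod_cast this
  rw [h3, ← mul_assoc, h2, mul_assoc]
  simp only [add_right_inj]
  rw [Finset.sum_filter, Finset.sum_ite_eq']
  split_ifs with ht
  · rfl
  · rw [Nat.choose_eq_zero_of_lt (n := A.card - r) (by simpa using ht)]; simp

lemma sum_piFinset_eq_sum_fiber {ι α : Type*} [Fintype ι] [DecidableEq ι]
    (A : ι → Finset α) (a : ι → α → ℂ) (f : ι → α → ℕ) (S : ι → Finset ℕ)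
    (hS : ∀ i, ∀ x ∈ A i, f i x ∈ S i) (Φ : (ι → ℕ) → ℂ) :
    ∑ x ∈ Fintype.piFinset A, (∏ i, a i (x i)) * Φ (fun i => f i (x i)) =
      ∑ s ∈ Fintype.piFinset S, (∏ i, ∑ x ∈ A i with f i x = s i, a i x) * Φ s := by
  rw [← Finset.sum_fiberwise_of_maps_to (s := Fintype.piFinset A) (t := Fintype.piFinset S)
    (g := fun x i => f i (x i)) (fun x hx => by
      rw [Fintype.mem_piFinset] at hx ⊢
      exact fun i => hS i _ (hx i))]
  refine Finset.sum_congr rfl fun s _ => ?_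
  rw [Finset.prod_univ_sum, Finset.sum_mul]
  refine Finset.sum_congr ?_ ?_
  · ext x
    simp [Fintype.mem_piFinset, funext_iff, forall_and]
  · intro x hx
    have : (fun i => f i (x i)) = s := funext fun i => by
      have := Fintype.mem_piFinset.1 hx i
      simp at this; exact this.2
    rw [this]

/-- A sum over a product of finite sets, weighted by a function of the `ℕ`-valued statistics,
only depends on the fibre sums of each factor. -/
lemma sum_piFinset_congr_fiber {ι α β : Type*} [Fintype ι] [DecidableEq ι]
    (A : ι → Finset α) (a : ι → α → ℂ) (f : ι → α → ℕ)
    (B : ι → Finset β) (b : ι → β → ℂ) (g : ι → β → ℕ)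
    (h : ∀ i s, ∑ x ∈ A i with f i x = s, a i x = ∑ y ∈ B i with g i y = s, b i y)
    (Φ : (ι → ℕ) → ℂ) :
    ∑ x ∈ Fintype.piFinset A, (∏ i, a i (x i)) * Φ (fun i => f i (x i)) =
      ∑ y ∈ Fintype.piFinset B, (∏ i, b i (y i)) * Φ (fun i => g i (y i)) := by
  rw [sum_piFinset_eq_sum_fiber A a f (fun i => (A i).image (f i) ∪ (B i).image (g i))
      (fun i x hx => Finset.mem_union_left _ (Finset.mem_image_of_mem _ hx)),
    sum_piFinset_eq_sum_fiber B b g (fun i => (A i).image (f i) ∪ (B i).image (g i))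
      (fun i x hx => Finset.mem_union_right _ (Finset.mem_image_of_mem _ hx))]
  simp only [h]

/-- If multiplication by a primitive `p`-th root of unity permutes the values `f x`, `x ∈ I`, all
of which are `p`-th roots of unity, then these are equidistributed. -/
lemma exists_prod_eq_of_equidistributed {α : Type*} [DecidableEq α] (I : Finset α) (f : α → ℂ)
    {p : ℕ} (hp : 0 < p) {ζ : ℂ} (hζ : IsPrimitiveRoot ζ p) (hf : ∀ x ∈ I, f x ^ p = 1)
    (σ : α → α) (hσ : Set.InjOn σ I) (hσI : ∀ x ∈ I, σ x ∈ I) (hσf : ∀ x ∈ I, f (σ x) = ζ * f x) :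
    ∃ M, I.card = p * M ∧ ∀ y : ℂ, ∏ x ∈ I, (1 + y * f x) = (1 - (-y) ^ p) ^ M := by
  have hle : ∀ c, (I.filter (f · = c)).card ≤ (I.filter (f · = ζ * c)).card := by
    intro c
    refine Finset.card_le_card_of_injOn σ ?_ (hσ.mono (by simp only [Finset.coe_subset, Finset.filter_subset]))
    intro x hx
    rw [Finset.mem_coe, Finset.mem_filter] at hx ⊢
    exact ⟨hσI x hx.1, by rw [hσf x hx.1, hx.2]⟩
  have hle' : ∀ c k, (I.filter (f · = c)).card ≤ (I.filter (f · = ζ ^ k * c)).card := by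
    intro c k
    induction k with
    | zero => simp
    | succ k ih => exact ih.trans ((hle _).trans_eq (by rw [pow_succ', mul_assoc]))
  have : NeZero p := ⟨hp.ne'⟩
  have hconst : ∀ c ∈ nthRootsFinset p (1 : ℂ),
      (I.filter (f · = c)).card = (I.filter (f · = 1)).card := by
    intro c hc
    rw [mem_nthRootsFinset hp] at hc
    obtain ⟨k, hk, rfl⟩ := hζ.eq_pow_of_pow_eq_one hc
    refine le_antisymm ?_ (by simpa using hle' 1 k)
    -- Another `p - k` multiplications by `ζ` close the cycle back to `1`, so the inequality between
    -- fibres also holds in reverse.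
    have := hle' (ζ ^ k) (p - k)
    rwa [← pow_add, Nat.sub_add_cancel hk.le, hζ.pow_eq_one] at this
  have hmaps : ∀ x ∈ I, f x ∈ nthRootsFinset p (1 : ℂ) := fun x hx => by
    rw [mem_nthRootsFinset hp]; exact hf x hx
  refine ⟨(I.filter (f · = 1)).card, ?_, fun y => ?_⟩
  · rw [Finset.card_eq_sum_card_fiberwise hmaps, Finset.sum_congr rfl hconst, Finset.sum_const,
      hζ.card_nthRootsFinset, smul_eq_mul]
  · rw [← Finset.prod_fiberwise_of_maps_to hmaps]
    -- Writing each factor as `1 - c * (-y)` allows factoring `1 ^ p - (-y) ^ p` without separating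
    -- `p = 2`.
    have h1 : ∀ c ∈ nthRootsFinset p (1 : ℂ), ∏ x ∈ I with f x = c, (1 + y * f x) =
        (1 - c * (-y)) ^ (I.filter (f · = 1)).card := by
      intro c hc
      rw [← hconst c hc, ← Finset.prod_const]
      refine Finset.prod_congr rfl fun x hx => ?_
      rw [(Finset.mem_filter.1 hx).2]; ring
    rw [Finset.prod_congr rfl h1, Finset.prod_pow, ← hζ.pow_sub_pow_eq_prod_sub_mul _ _ hp, one_pow]

/-- The hypothesis holds at every complex `y`, hence as an identity of polynomials; this compares
coefficients of `X ^ s`. -/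
lemma sum_powerset_prod_fiber {α : Type*} (I : Finset α) (f : α → ℂ) {p M : ℕ}
    (h : ∀ y : ℂ, ∏ x ∈ I, (1 + y * f x) = (1 - (-y) ^ p) ^ M) (s : ℕ) :
    ∑ D ∈ I.powerset with D.card = s, ∏ x ∈ D, f x =
      ∑ k ∈ Finset.range (M + 1) with p * k = s, (M.choose k : ℂ) * (-1) ^ (k + p * k) := by
  have hpoly : ∏ x ∈ I, (1 + X * C (f x)) = (1 + -(-X : ℂ[X]) ^ p) ^ M := by
    refine Polynomial.funext fun y => ?_
    rw [eval_prod]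
    simpa [sub_eq_add_neg, mul_comm y] using h y
  have := congrArg (fun P => P.coeff s) hpoly
  rw [Finset.prod_one_add, add_comm 1, add_pow] at this
  simp only [finsetSum_coeff, Finset.prod_mul_distrib, Finset.prod_const, ← map_prod,
    coeff_mul_C, coeff_X_pow] at this
  rw [Finset.sum_filter, Finset.sum_filter]
  refine Eq.trans (Finset.sum_congr rfl fun D _ => ?_) (this.trans
    (Finset.sum_congr rfl fun k _ => ?_))
  · by_cases hD : D.card = s <;> simp [hD, Ne.symm]
  · have : (-(-X : ℂ[X]) ^ p) ^ k * 1 ^ (M - k) * (M.choose k : ℂ[X]) =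
        C ((M.choose k : ℂ) * (-1) ^ (k + p * k)) * X ^ (p * k) := by
      rw [neg_pow, ← pow_mul, neg_pow (X : ℂ[X])]
      simp only [one_pow, mul_one, map_mul, map_pow, map_neg, map_one, map_natCast]
      ring
    rw [this, coeff_C_mul, coeff_X_pow]
    simp [eq_comm]

lemma sum_powerset_inversionWeight_prod_fiber {α : Type*} (I : Finset α) (f : α → ℂ) {p M : ℕ}
    (h : ∀ y : ℂ, ∏ x ∈ I, (1 + y * f x) = (1 - (-y) ^ p) ^ M) (r s : ℕ) :
    ∑ D ∈ I.powerset with D.card = s, inversionWeight D.card r * ∏ x ∈ D, f x =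
      ∑ k ∈ Finset.range (M + 1) with p * k = s,
        (M.choose k : ℂ) * ((p * k).choose r : ℂ) * (-1) ^ (k + r) := by
  have h1 : ∑ D ∈ I.powerset with D.card = s, inversionWeight D.card r * ∏ x ∈ D, f x =
      inversionWeight s r * ∑ D ∈ I.powerset with D.card = s, ∏ x ∈ D, f x := by
    rw [Finset.mul_sum]
    refine Finset.sum_congr rfl fun D hD => ?_
    rw [(Finset.mem_filter.1 hD).2]
  rw [h1, sum_powerset_prod_fiber I f h, Finset.mul_sum]
  refine Finset.sum_congr rfl fun k hk => ?_
  rw [← (Finset.mem_filter.1 hk).2, inversionWeight]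
  have : (-1 : ℂ) ^ (p * k + r) * (-1) ^ (k + p * k) = (-1) ^ (k + r) := by
    rw [← pow_add, show p * k + r + (k + p * k) = k + r + 2 * (p * k) by ring, pow_add, pow_mul]
    simp
  linear_combination (M.choose k : ℂ) * ((p * k).choose r : ℂ) * this

end Combinatorics

/-! ### Character sums over monic and irreducible polynomials. -/

section FiniteField

variable {F : Type*} [Field F]

lemma coeffClass_one_eq_iff {f g : F[X]} (hf : f.Monic) (hg : g.Monic) :
    coeffClass 1 f = coeffClass 1 g ↔ f.nextCoeff = g.nextCoeff := by
  rw [coeffClass, coeffClass, Ideal.Quotient.eq, Ideal.mem_span_singleton, X_pow_dvd_iff]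
  constructor
  · intro h
    have := h 1 (by norm_num)
    rwa [coeff_sub, coeff_one_reverse, coeff_one_reverse, sub_eq_zero] at this
  · intro h d hd
    interval_cases d
    · simp [hf.leadingCoeff, hg.leadingCoeff]
    · simp [coeff_one_reverse, h]

lemma nextCoeff_taylor {f : F[X]} (hf : f.Monic) (b : F) :
    (taylor b f).nextCoeff = f.nextCoeff + f.natDegree * b := by
  rcases hn : f.natDegree with _ | n
  · simp [nextCoeff, natDegree_taylor, hn]
  · rw [nextCoeff_of_natDegree_pos (by rw [natDegree_taylor]; omega),
      nextCoeff_of_natDegree_pos (by omega), natDegree_taylor, hn, Nat.add_sub_cancel, taylor_coeff,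
      eval_eq_sum_range' (n := 2)]
    · have : f.coeff (n + 1) = 1 := by rw [← hn]; exact hf
      simp [Finset.sum_range_succ, hasseDeriv_coeff, add_comm 1 n, this]
    · have := natDegree_hasseDeriv_le f n
      omega

lemma map_sum_eq_prod {A ι : Type*} [AddCommMonoid A] (ψ : AddChar A ℂ) (s : Finset ι)
    (f : ι → A) : ψ (∑ i ∈ s, f i) = ∏ i ∈ s, ψ (f i) :=
  map_prod ψ.toMonoidHom (fun i => Multiplicative.ofAdd (f i)) s

lemma isCoprime_of_monic_irreducible {P Q : F[X]} (hP : P.Monic) (hP' : Irreducible P)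
    (hQ : Q.Monic) (hQ' : Irreducible Q) (h : P ≠ Q) : IsCoprime P Q :=
  hP'.coprime_iff_not_dvd.2 fun hd =>
    h (eq_of_monic_of_associated hP hQ (hP'.associated_of_dvd hQ' hd))

variable [Finite F]

lemma finite_monic_natDegree (n : ℕ) : {g : F[X] | g.Monic ∧ g.natDegree = n}.Finite := by
  have : Finite (degreeLT F n) := Finite.of_equiv _ (degreeLTEquiv F n).symm.toEquiv
  exact Set.finite_coe_iff.1 (Finite.of_equiv _ (monicEquivDegreeLT n).symm)

variable (F) in
/-- The monic polynomials of degree `n` over a finite field. -/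
noncomputable def monicOfDegree (n : ℕ) : Finset F[X] := (finite_monic_natDegree n).toFinset

@[simp] lemma mem_monicOfDegree {n : ℕ} {g : F[X]} :
    g ∈ monicOfDegree F n ↔ g.Monic ∧ g.natDegree = n := by
  simp [monicOfDegree]

lemma card_monicOfDegree (n : ℕ) : (monicOfDegree F n).card = Nat.card F ^ n := by
  rw [monicOfDegree, ← Set.ncard_eq_toFinset_card _ (finite_monic_natDegree n), ← Nat.card_coe_set_eq]
  refine (Nat.card_congr ((monicEquivDegreeLT n).trans (degreeLTEquiv F n).toEquiv)).trans ?_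
  simp [Nat.card_fun]

lemma finite_monicIrred (i : ℕ) : (monicIrred F i).Finite :=
  (finite_monic_natDegree i).subset fun _ h => ⟨h.1, h.2.2⟩

variable (F) in
/-- `monicIrred F i` as a finset. -/
noncomputable def monicIrredFinset (i : ℕ) : Finset F[X] := (finite_monicIrred i).toFinset

@[simp] lemma mem_monicIrredFinset {i : ℕ} {g : F[X]} :
    g ∈ monicIrredFinset F i ↔ g.Monic ∧ Irreducible g ∧ g.natDegree = i := by
  simp [monicIrredFinset, monicIrred]

lemma card_monicIrredFinset (i : ℕ) : (monicIrredFinset F i).card = (monicIrred F i).ncard := by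
  rw [monicIrredFinset, ← Set.ncard_eq_toFinset_card _ (finite_monicIrred i)]

open Classical in
lemma numDistinctFactors_eq_card (i : ℕ) (g : F[X]) :
    numDistinctFactors i g = ((monicIrredFinset F i).filter (· ∣ g)).card := by
  rw [numDistinctFactors, ← Set.ncard_coe_finset]
  congr 1
  ext h
  simp [monicIrred]

/-- The character sum of the second coefficient over the monic polynomials of degree `n`. -/
noncomputable def monicCharSum (ψ : AddChar F ℂ) (n : ℕ) : ℂ :=
  ∑ h ∈ monicOfDegree F n, ψ h.nextCoeff

lemma monicCharSum_zero (n : ℕ) : monicCharSum (0 : AddChar F ℂ) n = (Nat.card F : ℂ) ^ n := by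
  simp [monicCharSum, card_monicOfDegree]

/-- For `n > 0`, adding `b * X ^ (n - 1)` permutes the monic polynomials and multiplies the sum by
`ψ b ≠ 1`. -/
lemma monicCharSum_of_ne_zero {ψ : AddChar F ℂ} (hψ : ψ ≠ 0) (n : ℕ) :
    monicCharSum ψ n = if n = 0 then 1 else 0 := by
  split_ifs with hn
  · subst hn
    have : monicOfDegree F 0 = {1} := by
      ext g
      simp only [mem_monicOfDegree, Finset.mem_singleton]
      exact ⟨fun h => h.1.natDegree_eq_zero.1 h.2, by rintro rfl; simp⟩
    rw [monicCharSum, this, Finset.sum_singleton, ← C_1, nextCoeff_C_eq_zero, ψ.map_zero_eq_one]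
  · obtain ⟨b, hb⟩ : ∃ b, ψ b ≠ 1 := by
      by_contra! h
      exact hψ (DFunLike.ext _ _ fun x => by simpa using h x)
    have hdeg : ∀ c : F, (C c * X ^ (n - 1)).degree < (n : WithBot ℕ) := fun c =>
      (degree_C_mul_X_pow_le _ _).trans_lt (by exact_mod_cast (by omega : n - 1 < n))
    have hmem : ∀ (c : F), ∀ g ∈ monicOfDegree F n,
        g + C c * X ^ (n - 1) ∈ monicOfDegree F n := by
      intro c g hg
      rw [mem_monicOfDegree] at hg ⊢
      have hlt : (C c * X ^ (n - 1)).degree < g.degree := by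
        rw [degree_eq_natDegree hg.1.ne_zero, hg.2]; exact hdeg c
      exact ⟨hg.1.add_of_left hlt, (natDegree_add_eq_left_of_degree_lt hlt).trans hg.2⟩
    have hnext : ∀ g ∈ monicOfDegree F n, g.nextCoeff = g.coeff (n - 1) := fun g hg => by
      rw [mem_monicOfDegree] at hg
      rw [nextCoeff_of_natDegree_pos (by omega), hg.2]
    have key : monicCharSum ψ n = ψ b * monicCharSum ψ n := by
      rw [monicCharSum, Finset.mul_sum]
      refine Finset.sum_bij' (fun g _ => g + C (-b) * X ^ (n - 1))
        (fun g _ => g + C b * X ^ (n - 1)) (fun g hg => hmem _ g hg) (fun g hg => hmem _ g hg)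
        (fun g _ => by simp) (fun g _ => by simp) (fun g hg => ?_)
      rw [← ψ.map_add_eq_mul, hnext _ (hmem _ g hg), hnext g hg]
      simp
    have : (ψ b - 1) * monicCharSum ψ n = 0 := by linear_combination -key
    exact (mul_eq_zero.1 this).resolve_left (sub_ne_zero.2 hb)

open Classical in
-- Substitute `g = Q * h` and use additivity of `nextCoeff`.
lemma sum_monicOfDegree_dvd (ψ : AddChar F ℂ) {Q : F[X]} (hQ : Q.Monic) (m : ℕ) :
    ∑ g ∈ monicOfDegree F m with Q ∣ g, ψ g.nextCoeff =
      ψ Q.nextCoeff * if Q.natDegree ≤ m then monicCharSum ψ (m - Q.natDegree) else 0 := by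
  split_ifs with h
  · rw [monicCharSum, Finset.mul_sum]
    symm
    refine Finset.sum_bij (fun h _ => Q * h) ?_ ?_ ?_ ?_
    · intro a ha
      rw [mem_monicOfDegree] at ha
      rw [Finset.mem_filter, mem_monicOfDegree]
      exact ⟨⟨hQ.mul ha.1, by rw [hQ.natDegree_mul ha.1]; omega⟩, dvd_mul_right _ _⟩
    · intro a _ b _ hab
      exact mul_left_cancel₀ hQ.ne_zero hab
    · intro g hg
      rw [Finset.mem_filter, mem_monicOfDegree] at hg
      obtain ⟨⟨hg1, hg2⟩, a, rfl⟩ := hg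
      have ha := hQ.of_mul_monic_left hg1
      refine ⟨a, ?_, rfl⟩
      rw [hQ.natDegree_mul ha] at hg2
      rw [mem_monicOfDegree]
      exact ⟨ha, by omega⟩
    · intro a ha
      rw [mem_monicOfDegree] at ha
      rw [hQ.nextCoeff_mul ha.1, ψ.map_add_eq_mul]
  · rw [mul_zero]
    refine Finset.sum_eq_zero fun g hg => absurd ?_ h
    rw [Finset.mem_filter, mem_monicOfDegree] at hg
    rw [← hg.1.2]
    exact natDegree_le_of_dvd hg.2 hg.1.1.ne_zero

variable {T : Finset ℕ}

lemma prod_dvd_iff_of_monicIrred {D : T → Finset F[X]}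
    (hD : ∀ i : T, D i ⊆ monicIrredFinset F i) (g : F[X]) :
    ∏ i, ∏ P ∈ D i, P ∣ g ↔ ∀ i, ∀ P ∈ D i, P ∣ g := by
  have hmem : ∀ i, ∀ P ∈ D i, P.Monic ∧ Irreducible P ∧ P.natDegree = i :=
    fun i P hP => mem_monicIrredFinset.1 (hD i hP)
  constructor
  · intro h i P hP
    exact (Finset.dvd_prod_of_mem _ hP).trans ((Finset.dvd_prod_of_mem _ (Finset.mem_univ i)).trans h)
  · intro h
    refine Finset.prod_dvd_of_coprime ?_ fun i _ => Finset.prod_dvd_of_coprime ?_ (h i)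
    · intro i _ j _ hij
      refine IsCoprime.prod_left fun P hP => IsCoprime.prod_right fun Q hQ => ?_
      have h1 := hmem i P hP
      have h2 := hmem j Q hQ
      refine isCoprime_of_monic_irreducible h1.1 h1.2.1 h2.1 h2.2.1 ?_
      rintro rfl
      exact hij (Subtype.ext (h1.2.2.symm.trans h2.2.2))
    · intro P hP Q hQ hPQ
      have h1 := hmem i P hP
      have h2 := hmem i Q hQ
      exact isCoprime_of_monic_irreducible h1.1 h1.2.1 h2.1 h2.2.1 hPQ

open Classical in
lemma ite_numDistinctFactors_eq_sum (i r : ℕ) (g : F[X]) :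
    (if numDistinctFactors i g = r then (1 : ℂ) else 0) =
      ∑ D ∈ (monicIrredFinset F i).powerset,
        inversionWeight D.card r * if ∀ P ∈ D, P ∣ g then 1 else 0 := by
  rw [numDistinctFactors_eq_card, ← sum_powerset_inversionWeight]
  simp only [mul_ite, mul_one, mul_zero]
  -- The sets `D` all of whose members divide `g` are the subsets of the set of degree-`i`
  -- irreducible factors of `g`.
  rw [← Finset.sum_filter]
  refine Finset.sum_congr ?_ fun _ _ => rfl
  ext D
  simp only [Finset.mem_powerset, Finset.subset_iff, Finset.mem_filter]
  exact ⟨fun h => ⟨fun P hP => (h hP).1, fun P hP => (h hP).2⟩, fun h P hP => ⟨h.1 hP, h.2 P hP⟩⟩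

open Classical in
/-- Inclusion-exclusion for the character sum over monic polynomials with prescribed numbers of
distinct irreducible factors. -/
lemma sum_numDistinctFactors_eq (ψ : AddChar F ℂ) (m : ℕ) (r : T → ℕ) :
    ∑ g ∈ monicOfDegree F m with ∀ i : T, numDistinctFactors (i : ℕ) g = r i, ψ g.nextCoeff =
      ∑ D ∈ Fintype.piFinset fun i : T => (monicIrredFinset F i).powerset,
        (∏ i, inversionWeight (D i).card (r i) * ∏ P ∈ D i, ψ P.nextCoeff) *
          if ∑ i : T, (i : ℕ) * (D i).card ≤ m then
            monicCharSum ψ (m - ∑ i : T, (i : ℕ) * (D i).card) else 0 := by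
  have hg : ∀ g : F[X], (if ∀ i : T, numDistinctFactors (i : ℕ) g = r i then ψ g.nextCoeff else 0) =
      ∑ D ∈ Fintype.piFinset fun i : T => (monicIrredFinset F i).powerset,
        (∏ i, inversionWeight (D i).card (r i)) *
          if ∏ i, ∏ P ∈ D i, P ∣ g then ψ g.nextCoeff else 0 := by
    intro g
    have h1 : (if ∀ i : T, numDistinctFactors (i : ℕ) g = r i then ψ g.nextCoeff else 0) =
        (∏ i : T, if numDistinctFactors (i : ℕ) g = r i then (1 : ℂ) else 0) * ψ g.nextCoeff := by
      rw [Finset.prod_ite_zero]; simp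
    rw [h1, Finset.prod_congr rfl fun i _ => ite_numDistinctFactors_eq_sum _ _ _,
      Finset.prod_univ_sum, Finset.sum_mul]
    refine Finset.sum_congr rfl fun D hD => ?_
    rw [prod_dvd_iff_of_monicIrred fun i => Finset.mem_powerset.1 (Fintype.mem_piFinset.1 hD i),
      Finset.prod_mul_distrib, Finset.prod_ite_zero, mul_assoc]
    simp
  rw [Finset.sum_filter, Finset.sum_congr rfl fun g _ => hg g, Finset.sum_comm]
  refine Finset.sum_congr rfl fun D hD => ?_
  have hmem : ∀ i, ∀ P ∈ D i, P.Monic ∧ Irreducible P ∧ P.natDegree = i := fun i P hP =>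
    mem_monicIrredFinset.1 (Finset.mem_powerset.1 (Fintype.mem_piFinset.1 hD i) hP)
  have hm : ∀ i, (∏ P ∈ D i, P).Monic := fun i => monic_prod_of_monic _ _ fun P hP => (hmem i P hP).1
  have hQ : (∏ i, ∏ P ∈ D i, P).Monic := monic_prod_of_monic _ _ fun i _ => hm i
  have hdeg : (∏ i, ∏ P ∈ D i, P).natDegree = ∑ i : T, (i : ℕ) * (D i).card := by
    rw [natDegree_prod_of_monic _ _ fun i _ => hm i]
    refine Finset.sum_congr rfl fun i _ => ?_
    rw [natDegree_prod_of_monic _ _ fun P hP => (hmem i P hP).1,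
      Finset.sum_congr rfl fun P hP => (hmem i P hP).2.2]
    simp [mul_comm]
  have hnext : ψ (∏ i, ∏ P ∈ D i, P).nextCoeff = ∏ i, ∏ P ∈ D i, ψ P.nextCoeff := by
    rw [Monic.nextCoeff_prod _ _ fun i _ => hm i, map_sum_eq_prod ψ]
    refine Finset.prod_congr rfl fun i _ => ?_
    rw [Monic.nextCoeff_prod _ _ fun P hP => (hmem i P hP).1, map_sum_eq_prod ψ]
  rw [← Finset.mul_sum, ← Finset.sum_filter, sum_monicOfDegree_dvd ψ hQ, hnext, hdeg,
    Finset.prod_mul_distrib, mul_assoc]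

lemma exists_monicIrred_prod_eq {p : ℕ} (hp : p.Prime) [CharP F p] {ψ : AddChar F ℂ} (hψ : ψ ≠ 0)
    {i : ℕ} (hi : ¬ p ∣ i) :
    ∃ M, (monicIrredFinset F i).card = p * M ∧
      ∀ y : ℂ, ∏ P ∈ monicIrredFinset F i, (1 + y * ψ P.nextCoeff) = (1 - (-y) ^ p) ^ M := by
  classical
  obtain ⟨b, hb⟩ : ∃ b, ψ b ≠ 1 := by
    by_contra! h
    exact hψ (DFunLike.ext _ _ fun x => by simpa using h x)
  have hpow : ∀ c, ψ c ^ p = 1 := fun c => by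
    rw [← ψ.map_nsmul_eq_pow, nsmul_eq_mul, CharP.cast_eq_zero, zero_mul, ψ.map_zero_eq_one]
  have hi0 : (i : F) ≠ 0 := by rwa [Ne, CharP.cast_eq_zero_iff F p]
  have : Fact p.Prime := ⟨hp⟩
  -- A `p`-th root of unity other than `1` is primitive because `p` is prime.
  have hζ : IsPrimitiveRoot (ψ b) p := orderOf_eq_prime (hpow b) hb ▸ IsPrimitiveRoot.orderOf _
  refine exists_prod_eq_of_equidistributed _ _ hp.pos hζ (fun P _ => hpow _)
    (taylor (b / i)) (taylor_injective _).injOn ?_ ?_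
  · intro P hP
    rw [mem_monicIrredFinset] at hP ⊢
    refine ⟨?_, ?_, by rw [natDegree_taylor, hP.2.2]⟩
    · rw [Monic, leadingCoeff_taylor]; exact hP.1
    · rw [← coe_taylorEquiv]
      exact (MulEquiv.irreducible_iff (taylorEquiv (b / (i : F)))).2 hP.2.1
  · intro P hP
    rw [mem_monicIrredFinset] at hP
    rw [nextCoeff_taylor hP.1, hP.2.2, mul_div_cancel₀ _ hi0, ψ.map_add_eq_mul, mul_comm]

end FiniteField

/-! ### Evaluation of the character sums and Fourier inversion. -/

section Counting

variable {F : Type*} [Field F] [Finite F] {T : Finset ℕ}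

open Classical in
lemma sum_numDistinctFactors_trivial (m : ℕ) (r : T → ℕ) :
    ∑ g ∈ monicOfDegree F m with ∀ i : T, numDistinctFactors (i : ℕ) g = r i,
        (0 : AddChar F ℂ) g.nextCoeff =
      ∑ j ∈ Fintype.piFinset
          (fun i : T => Finset.range ((monicIrred F i).ncard - r i + 1)),
        (∏ i : T, ((monicIrred F i).ncard.choose (r i) : ℂ) *
          (((monicIrred F i).ncard - r i).choose (j i) * (-1) ^ j i)) *
          if ∑ i : T, (i : ℕ) * (r i + j i) ≤ m then
            (Nat.card F : ℂ) ^ (m - ∑ i : T, (i : ℕ) * (r i + j i)) else 0 := by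
  rw [sum_numDistinctFactors_eq]
  simp only [monicCharSum_zero, AddChar.zero_apply, Finset.prod_const_one, mul_one,
    ← card_monicIrredFinset]
  exact sum_piFinset_congr_fiber (fun i : T => (monicIrredFinset F i).powerset)
    (fun i D => inversionWeight D.card (r i)) (fun _ D => D.card)
    (fun i : T => Finset.range ((monicIrredFinset F i).card - r i + 1))
    (fun i j => ((monicIrredFinset F i).card.choose (r i) : ℂ) *
      (((monicIrredFinset F i).card - r i).choose j * (-1) ^ j)) (fun i j => r i + j)
    (fun i s => sum_powerset_inversionWeight_fiber _ (r i) s)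
    (fun s => if ∑ i : T, (i : ℕ) * s i ≤ m then
      (Nat.card F : ℂ) ^ (m - ∑ i : T, (i : ℕ) * s i) else 0)

open Classical in
lemma sum_numDistinctFactors_nontrivial {p : ℕ} (hp : p.Prime) [CharP F p] {ψ : AddChar F ℂ}
    (hψ : ψ ≠ 0) (hT : ∀ i ∈ T, ¬ p ∣ i) (m : ℕ) (r : T → ℕ) :
    ∑ g ∈ monicOfDegree F m with ∀ i : T, numDistinctFactors (i : ℕ) g = r i, ψ g.nextCoeff =
      ∑ k ∈ Fintype.piFinset
          (fun i : T => Finset.range ((monicIrred F i).ncard / p + 1)),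
        (∏ i : T, (((monicIrred F i).ncard / p).choose (k i) : ℂ) *
          ((p * k i).choose (r i) : ℂ) * (-1) ^ (k i + r i)) *
          if ∑ i : T, (i : ℕ) * (p * k i) = m then 1 else 0 := by
  rw [sum_numDistinctFactors_eq]
  -- A nontrivial character kills every cofactor of positive degree, so the bound on the degree
  -- becomes an equality.
  have hH : ∀ s : ℕ, (if s ≤ m then monicCharSum ψ (m - s) else 0) =
      if s = m then (1 : ℂ) else 0 := by
    intro s
    rw [monicCharSum_of_ne_zero hψ]
    by_cases h : s = m
    · simp [h]
    · by_cases h' : s ≤ m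
      · rw [if_pos h', if_neg h, if_neg (by omega)]
      · rw [if_neg h', if_neg h]
  simp only [hH]
  refine sum_piFinset_congr_fiber (fun i : T => (monicIrredFinset F i).powerset)
    (fun (i : T) D => inversionWeight D.card (r i) * ∏ P ∈ D, ψ P.nextCoeff) (fun _ D => D.card)
    (fun i : T => Finset.range ((monicIrred F i).ncard / p + 1))
    (fun (i : T) k => (((monicIrred F i).ncard / p).choose k : ℂ) * ((p * k).choose (r i) : ℂ) *
      (-1) ^ (k + r i)) (fun _ k => p * k) (fun i s => ?_)
    (fun s => if ∑ i : T, (i : ℕ) * s i = m then 1 else 0)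
  obtain ⟨M, hM, hprod⟩ := exists_monicIrred_prod_eq hp hψ (hT i i.2)
  have hM' : (monicIrred F i).ncard / p = M := by
    rw [← card_monicIrredFinset, hM, Nat.mul_div_cancel_left _ hp.pos]
  rw [hM']
  exact sum_powerset_inversionWeight_prod_fiber _ _ hprod (r i) s

open Classical in
lemma N_one_eq_card (m : ℕ) (r : T → ℕ) (α : F) :
    N 1 m T r (X + C α) = (((monicOfDegree F m).filter fun g =>
      ∀ i : T, numDistinctFactors (i : ℕ) g = r i).filter fun g => g.nextCoeff = α).card := by
  rw [N, ← Set.ncard_coe_finset]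
  congr 1
  ext g
  simp only [Finset.coe_filter, Finset.mem_filter, mem_monicOfDegree, Set.mem_ofPred_eq]
  have hα : (X + C α).nextCoeff = α := nextCoeff_X_add_C α
  constructor
  · rintro ⟨h1, h2, h3, h4⟩
    rw [coeffClass_one_eq_iff h1 (monic_X_add_C α), hα] at h3
    exact ⟨⟨⟨h1, h2⟩, h4⟩, h3⟩
  · rintro ⟨⟨⟨h1, h2⟩, h4⟩, h3⟩
    refine ⟨h1, h2, ?_, h4⟩
    rwa [coeffClass_one_eq_iff h1 (monic_X_add_C α), hα]

open Classical in
/-- Fourier inversion for the counting function `N`, when the sum for a nontrivial character does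
not depend on the character. -/
lemma card_mul_N_one_eq (m : ℕ) (r : T → ℕ) (α : F) {A : ℂ}
    (hA : ∀ ψ : AddChar F ℂ, ψ ≠ 0 →
      ∑ g ∈ monicOfDegree F m with ∀ i : T, numDistinctFactors (i : ℕ) g = r i,
        ψ g.nextCoeff = A) :
    (Nat.card F : ℂ) * N 1 m T r (X + C α) =
      ∑ g ∈ monicOfDegree F m with ∀ i : T, numDistinctFactors (i : ℕ) g = r i,
        (0 : AddChar F ℂ) g.nextCoeff + (v α : ℂ) * A := by
  have := Fintype.ofFinite F
  set G := (monicOfDegree F m).filter fun g => ∀ i : T, numDistinctFactors (i : ℕ) g = r i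
  have hsum : ∀ a : F, ∑ ψ : AddChar F ℂ, ψ a = if a = 0 then (Nat.card F : ℂ) else 0 := by
    intro a
    rw [Nat.card_eq_fintype_card]
    exact AddChar.sum_apply_eq_ite a
  have h1 : (Nat.card F : ℂ) * N 1 m T r (X + C α) =
      ∑ ψ : AddChar F ℂ, ψ (-α) * ∑ g ∈ G, ψ g.nextCoeff := by
    simp only [Finset.mul_sum, ← AddChar.map_add_eq_mul]
    rw [Finset.sum_comm, N_one_eq_card]
    simp only [hsum, neg_add_eq_zero, eq_comm (a := α)]
    rw [← Finset.sum_filter, Finset.sum_const, nsmul_eq_mul, mul_comm]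
  -- Orthogonality over all characters, minus the contribution `1` of the trivial one.
  have h2 : ∑ ψ ∈ Finset.univ.erase (0 : AddChar F ℂ), ψ (-α) = (v α : ℂ) := by
    rw [Finset.sum_erase_eq_sub (Finset.mem_univ _), hsum, v]
    by_cases hα : α = 0 <;> simp [hα]
  rw [h1, ← Finset.add_sum_erase _ _ (Finset.mem_univ 0), AddChar.zero_apply, one_mul, ← h2,
    Finset.sum_mul]
  congr 1
  exact Finset.sum_congr rfl fun ψ hψ => by rw [hA ψ (Finset.ne_of_mem_erase hψ)]

/-- Collects the powers of `q`: the natural subtraction in the exponent is exact under the bracket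
condition, while the integer exponent `m - 1` also covers `m = 0`. -/
lemma zpow_mul_prod_mul_sum_eq {q : ℚ} (hq : q ≠ 0) (m : ℕ) (r n : T → ℕ) :
    q * (q ^ ((m : ℤ) - 1) * (∏ i : T, ((n i).choose (r i) : ℚ) * q ^ (-((i : ℤ) * (r i : ℤ)))) *
      ∑ j ∈ Fintype.piFinset (fun i : T => Finset.range (n i - r i + 1)),
        (∏ i : T, q ^ (-((i : ℤ) * (j i : ℤ))) * ((n i - r i).choose (j i) : ℚ) *
          (-1 : ℚ) ^ (j i)) * (if ∑ i : T, (i : ℕ) * (r i + j i) ≤ m then 1 else 0)) =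
      ∑ j ∈ Fintype.piFinset (fun i : T => Finset.range (n i - r i + 1)),
        (∏ i : T, ((n i).choose (r i) : ℚ) * ((n i - r i).choose (j i) * (-1) ^ j i)) *
          if ∑ i : T, (i : ℕ) * (r i + j i) ≤ m then
            q ^ (m - ∑ i : T, (i : ℕ) * (r i + j i)) else 0 := by
  rw [Finset.mul_sum, Finset.mul_sum]
  refine Finset.sum_congr rfl fun j _ => ?_
  split_ifs with h
  · have h1 : q ^ (m - ∑ i : T, (i : ℕ) * (r i + j i)) =
        q * q ^ ((m : ℤ) - 1) * ((∏ i : T, q ^ (-((i : ℤ) * (r i : ℤ)))) *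
          ∏ i : T, q ^ (-((i : ℤ) * (j i : ℤ)))) := by
      have h2 : ∀ i : T, q ^ (-((i : ℤ) * (r i : ℤ))) * q ^ (-((i : ℤ) * (j i : ℤ))) =
          (q ^ ((i : ℕ) * (r i + j i)))⁻¹ := by
        intro i
        rw [← zpow_add₀ hq, ← zpow_natCast, ← zpow_neg]
        congr 1
        push_cast; ring
      rw [← Finset.prod_mul_distrib, Finset.prod_congr rfl fun i _ => h2 i, Finset.prod_inv_distrib,
        Finset.prod_pow_eq_pow_sum, pow_sub₀ q hq h, ← zpow_one_add₀ hq]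
      simp
    rw [h1]
    simp only [Finset.prod_mul_distrib]
    ring
  · simp

end Counting

end PrescribedFactors

theorem corollary7p4 {F : Type*} [Field F] (p e q : ℕ) (hp : p.Prime) (he : 0 < e)
    (hq : q = p ^ e) (hF : Nat.card F = q)
    (T : Finset ℕ) (hT : ∀ i ∈ T, ¬ p ∣ i) (r : T → ℕ) (m : ℕ) (α : F) :
    (∀ i ∈ T, p ∣ (PrescribedFactors.monicIrred F i).ncard) ∧
    (¬ p ∣ m →
      (PrescribedFactors.N 1 m T r (Polynomial.X + Polynomial.C α) : ℚ) =
        (q : ℚ) ^ ((m : ℤ) - 1) *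
          (∏ i : T, ((PrescribedFactors.monicIrred F i).ncard.choose (r i) : ℚ) *
            (q : ℚ) ^ (-((i : ℤ) * (r i : ℤ)))) *
          ∑ j ∈ Fintype.piFinset
              (fun i : T => Finset.range ((PrescribedFactors.monicIrred F i).ncard - r i + 1)),
            (∏ i : T, (q : ℚ) ^ (-((i : ℤ) * (j i : ℤ))) *
              (((PrescribedFactors.monicIrred F i).ncard - r i).choose (j i) : ℚ) *
              (-1 : ℚ) ^ (j i)) *
            (if ∑ i : T, (i : ℕ) * (r i + j i) ≤ m then 1 else 0)) ∧
    (p ∣ m →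
      (PrescribedFactors.N 1 m T r (Polynomial.X + Polynomial.C α) : ℚ) =
        (q : ℚ) ^ ((m : ℤ) - 1) *
          (∏ i : T, ((PrescribedFactors.monicIrred F i).ncard.choose (r i) : ℚ) *
            (q : ℚ) ^ (-((i : ℤ) * (r i : ℤ)))) *
          (∑ j ∈ Fintype.piFinset
              (fun i : T => Finset.range ((PrescribedFactors.monicIrred F i).ncard - r i + 1)),
            (∏ i : T, (q : ℚ) ^ (-((i : ℤ) * (j i : ℤ))) *
              (((PrescribedFactors.monicIrred F i).ncard - r i).choose (j i) : ℚ) *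
              (-1 : ℚ) ^ (j i)) *
            (if ∑ i : T, (i : ℕ) * (r i + j i) ≤ m then 1 else 0)) +
        PrescribedFactors.v α / q *
          ∑ k ∈ Fintype.piFinset
              (fun i : T => Finset.range ((PrescribedFactors.monicIrred F i).ncard / p + 1)),
            (∏ i : T, (((PrescribedFactors.monicIrred F i).ncard / p).choose (k i) : ℚ) *
              ((p * k i).choose (r i) : ℚ) *
              (-1 : ℚ) ^ ((k i : ℤ) - (r i : ℤ))) *
            (if ∑ i : T, (i : ℕ) * k i = m / p then 1 else 0)) := by
  have hq0 : q ≠ 0 := hq ▸ (pow_pos hp.pos e).ne'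
  have hqQ : (q : ℚ) ≠ 0 := Nat.cast_ne_zero.2 hq0
  have : Finite F := Nat.finite_of_card_ne_zero (hF ▸ hq0)
  have : Fintype F := Fintype.ofFinite F
  have : Fact p.Prime := ⟨hp⟩
  have : CharP F p := charP_of_card_eq_prime_pow (f := e) (by rw [← Nat.card_eq_fintype_card, hF, hq])
  have hmain := PrescribedFactors.card_mul_N_one_eq m r α fun ψ hψ =>
    PrescribedFactors.sum_numDistinctFactors_nontrivial hp hψ hT m r
  rw [PrescribedFactors.sum_numDistinctFactors_trivial, hF] at hmain
  have hmainQ : (q : ℚ) * PrescribedFactors.N 1 m T r (X + C α) =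
      ∑ j ∈ Fintype.piFinset
          (fun i : T => Finset.range ((PrescribedFactors.monicIrred F i).ncard - r i + 1)),
        (∏ i : T, ((PrescribedFactors.monicIrred F i).ncard.choose (r i) : ℚ) *
          (((PrescribedFactors.monicIrred F i).ncard - r i).choose (j i) * (-1) ^ j i)) *
          (if ∑ i : T, (i : ℕ) * (r i + j i) ≤ m then
            (q : ℚ) ^ (m - ∑ i : T, (i : ℕ) * (r i + j i)) else 0) +
      PrescribedFactors.v α *
      ∑ k ∈ Fintype.piFinset
          (fun i : T => Finset.range ((PrescribedFactors.monicIrred F i).ncard / p + 1)),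
        (∏ i : T, (((PrescribedFactors.monicIrred F i).ncard / p).choose (k i) : ℚ) *
          ((p * k i).choose (r i) : ℚ) * (-1) ^ (k i + r i)) *
          (if ∑ i : T, (i : ℕ) * (p * k i) = m then 1 else 0) := by
    -- Both sides are rational, so the identity obtained with complex characters descends to `ℚ`.
    apply Rat.cast_injective (α := ℂ)
    push_cast [apply_ite (Rat.cast : ℚ → ℂ)]
    exact hmain
  rw [← PrescribedFactors.zpow_mul_prod_mul_sum_eq hqQ] at hmainQ
  have hcomm : ∀ k : T → ℕ, ∑ i : T, (i : ℕ) * (p * k i) = p * ∑ i : T, (i : ℕ) * k i := by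
    intro k
    rw [Finset.mul_sum]
    exact Finset.sum_congr rfl fun i _ => by ring
  refine ⟨fun i hi => ?_, fun hm => ?_, fun hm => ?_⟩
  · obtain ⟨ψ, hψ⟩ := AddChar.exists_apply_ne_zero.2 (one_ne_zero (α := F))
    have hψ0 : ψ ≠ 0 := by rintro rfl; simp at hψ
    obtain ⟨M, hM, -⟩ := PrescribedFactors.exists_monicIrred_prod_eq hp hψ0 (hT i hi)
    exact ⟨M, by rw [← PrescribedFactors.card_monicIrredFinset, hM]⟩
  · refine mul_left_cancel₀ hqQ (hmainQ.trans ?_)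
    rw [Finset.sum_eq_zero (s := Fintype.piFinset
      (fun i : T => Finset.range ((PrescribedFactors.monicIrred F i).ncard / p + 1))), mul_zero,
      add_zero]
    intro k _
    rw [if_neg, mul_zero]
    rw [hcomm]
    rintro rfl
    exact hm (dvd_mul_right _ _)
  · obtain ⟨m', hm'⟩ := hm
    refine mul_left_cancel₀ hqQ (hmainQ.trans ?_)
    rw [mul_add, ← mul_assoc (q : ℚ) (_ / _), mul_div_cancel₀ _ hqQ]
    congr 2
    refine Finset.sum_congr rfl fun k _ => ?_
    congr 1
    · refine Finset.prod_congr rfl fun i _ => ?_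
      -- The signs agree because `-1` is its own inverse.
      rw [zpow_sub₀ (by norm_num), pow_add, div_eq_mul_inv, ← inv_zpow]
      norm_num
    · rw [hcomm, hm', Nat.mul_div_cancel_left _ hp.pos]
      exact if_congr (Nat.mul_right_inj hp.ne_zero) rfl rfl
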